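/- Let $L$ be a finite distributive lattice with at least two elements, let $K$ be a field, and let $A$ be the incidence algebra of $L$ over $K$, i.e. the $K$-algebra with $K$-basis $\{p^x_y \mid x,y\in L,\ x\le y\}$ and multiplication $p^{x}_{y}\,p^{x'}_{y'}=p^{x}_{y'}$ if $y=x'$ and $p^{x}_{y}\,p^{x'}_{y'}=0$ otherwise. Then $$\operatorname{gldim} A=\operatorname{dim}(L)=\max\{|\operatorname{cov}(x)| \mid x\in L\},$$ where $\operatorname{gldim} A$ is the global dimension of $A$, i.e. the supremum of the projective dimensions of the finitely generated right $A$-modules; $\operatorname{dim}(L)$ is the order dimension of $L$, i.e. the smallest number $t$ such that there exist $t$ linear extensions of the order of $L$ (total orders on the set $L$ containing it) whose intersection is the order of $L$; and $\operatorname{cov}(x)$ is the set of elements of $L$ that cover $x$, i.e. of all $y>x$ such that no $u\in L$ satisfies $x<u<y$. -/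

import Mathlib

universe u v

open CategoryTheory

/-- The right global dimension of a ring `R`: the supremum of the projective dimensions of the
finitely generated right `R`-modules, a right `R`-module being a module over `Rᵐᵒᵖ`. -/
noncomputable def globalDimension (R : Type u) [Ring R] : WithBot ℕ∞ :=
  ⨆ (M : ModuleCat.{u} Rᵐᵒᵖ) (_ : Module.Finite Rᵐᵒᵖ M), projectiveDimension M

/-- A relation `r` is a linear extension of the partial order of `P` if it is a total
(linear, non-strict) order and contains `≤`. -/
def IsLinearExtension {P : Type u} [PartialOrder P] (r : P → P → Prop) : Prop :=
  IsLinearOrder P r ∧ ∀ x y : P, x ≤ y → r x y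

/-- The order dimension of a poset `P`: the least `t` such that `≤` is the intersection of `t`
linear extensions (and `⊤` if there is no such `t`, which does not happen for finite `P`). -/
noncomputable def orderDimension (P : Type u) [PartialOrder P] : ℕ∞ :=
  ⨅ (t : ℕ) (_ : ∃ r : Fin t → P → P → Prop,
      (∀ i, IsLinearExtension (r i)) ∧ ∀ x y : P, x ≤ y ↔ ∀ i, r i x y), (t : ℕ∞)

/-- The set of elements that cover `x`. -/
def cov {P : Type u} [PartialOrder P] (x : P) : Set P :=
  {y | x ⋖ y}

/-! Both invariants are compared with the maximal number of covers. Order dimension: if `T` is the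
set of covers of `x`, distributivity shows that no `y ∈ T` lies below the join of `x` and the other
covers. Some linear extension therefore puts `y` above all of `T`, and distinct `y` need distinct
extensions. Conversely, an antichain of join-irreducibles yields an element with at least as many
covers, so Dilworth's theorem splits the join-irreducibles into `k` chains, where `k` bounds the
number of covers. Each chain gives one linear extension, and together they recover the order because
every element is the join of the join-irreducibles below it. Global dimension: let `Q(x, l)` be the
quotient of `e_x A` by the `p^x_y A` with `y ∈ l`, for `y` above `x`. The sequences `0 → Q(x ⊔ y, l)
→ Q(x, l) → Q(x, y :: l) → 0` bound its projective dimension by the length of `l`. If `l` lists the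
covers of `x`, then `Q(x, l)` is the simple module at `x`, and filtering by simple modules gives the
upper bound. For the lower bound, the independence of the covers makes the connecting maps injective
on `Ext` into the simple module at the join of the covers, so a nonzero class survives in degree
`l.length`. -/

/-! ### Dilworth's theorem, by Galvin's induction on a maximal element -/

section Dilworth

variable {α : Type*} [PartialOrder α]

/-- **Dilworth's theorem**: a finite set all of whose antichains have at most `k` elements is the
union of `k` chains, given as the fibres of a colouring. -/
theorem exists_chain_coloring (s : Finset α) (k : ℕ)
    (h : ∀ A ⊆ s, IsAntichain (· ≤ ·) (A : Set α) → A.card ≤ k) :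
    ∃ c : α → ℕ, (∀ a ∈ s, c a < k) ∧ ∀ a ∈ s, ∀ b ∈ s, c a = c b → a ≤ b ∨ b ≤ a := by
  classical
  induction hn : s.card using Nat.strong_induction_on generalizing s k with
  | _ n ih =>
  rcases s.eq_empty_or_nonempty with rfl | hs
  · exact ⟨fun _ => 0, by simp, by simp⟩
  obtain ⟨a, has, hamax⟩ := s.exists_maximal hs
  set s' := s.erase a with hs'
  have hs's : s' ⊆ s := Finset.erase_subset _ _
  let F : Finset (Finset α) := s'.powerset.filter fun A => IsAntichain (· ≤ ·) (A : Set α)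
  have hF : ∀ A, A ∈ F ↔ A ⊆ s' ∧ IsAntichain (· ≤ ·) (A : Set α) := by simp [F]
  obtain ⟨A₀, hA₀, hmaxA⟩ := F.exists_max_image Finset.card ⟨∅, by simp [hF]⟩
  set w := A₀.card with hw
  obtain ⟨c, hcw, hc⟩ := ih s'.card (by rw [← hn]; exact Finset.card_erase_lt_of_mem has) s' w
    (fun A h1 h2 => hmaxA A ((hF A).2 ⟨h1, h2⟩)) rfl
  have hwk : w ≤ k := h A₀ (((hF _).1 hA₀).1.trans hs's) ((hF _).1 hA₀).2
  -- An antichain has at most one element of each colour, so one with `w` elements uses all `w`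
  -- colours.
  have hmeet : ∀ A ∈ F, A.card = w → ∀ i < w, ∃ y ∈ A, c y = i := by
    intro A hA hAw i hi
    obtain ⟨hA1, hA2⟩ := (hF A).1 hA
    have hinj : Set.InjOn c A := by
      intro p hp q hq hpq
      by_contra hne
      rcases hc p (hA1 hp) q (hA1 hq) hpq with h1 | h1
      · exact hA2 hp hq hne h1
      · exact hA2 hq hp (Ne.symm hne) h1
    have himg : A.image c = Finset.range w := by
      apply Finset.eq_of_subset_of_card_le
      · intro j hj
        obtain ⟨p, hp, rfl⟩ := Finset.mem_image.1 hj
        exact Finset.mem_range.2 (hcw p (hA1 hp))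
      · rw [Finset.card_image_of_injOn hinj, Finset.card_range, hAw]
    have := Finset.mem_range.2 hi
    rw [← himg] at this
    exact Finset.mem_image.1 this
  let G : ℕ → Finset α := fun i => s'.filter fun y => c y = i ∧ ∃ A ∈ F, A.card = w ∧ y ∈ A
  have hx : ∀ i, i < w → ∃ x ∈ G i, ∀ y ∈ G i, y ≤ x := by
    intro i hi
    have hne : (G i).Nonempty := by
      obtain ⟨y, hy, hyi⟩ := hmeet A₀ hA₀ rfl i hi
      exact ⟨y, Finset.mem_filter.2 ⟨((hF _).1 hA₀).1 hy, hyi, A₀, hA₀, rfl, hy⟩⟩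
    obtain ⟨x, hxG, hxm⟩ := (G i).exists_maximal hne
    refine ⟨x, hxG, fun y hy => ?_⟩
    have h1 := Finset.mem_filter.1 hxG
    have h2 := Finset.mem_filter.1 hy
    rcases hc x h1.1 y h2.1 (h1.2.1.trans h2.2.1.symm) with h3 | h3
    · exact hxm hy h3
    · exact h3
  have : Nonempty α := ⟨a⟩
  choose! x hxG hxm using hx
  have hxs : ∀ i < w, x i ∈ s' := fun i hi => (Finset.mem_filter.1 (hxG i hi)).1
  have hxc : ∀ i < w, c (x i) = i := fun i hi => (Finset.mem_filter.1 (hxG i hi)).2.1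
  -- A `w`-antichain through `x j` contains some `y ≤ x i` of colour `i`. If `x i ≤ x j`, then `y`
  -- and `x j` are comparable, hence equal.
  have hanti : ∀ i < w, ∀ j < w, x i ≤ x j → i = j := by
    intro i hi j hj hij
    obtain ⟨-, -, A, hA, hAw, hjA⟩ := Finset.mem_filter.1 (hxG j hj)
    obtain ⟨y, hyA, hyi⟩ := hmeet A hA hAw i hi
    have hyx := hxm i hi y (Finset.mem_filter.2 ⟨((hF _).1 hA).1 hyA, hyi, A, hA, hAw, hyA⟩)
    have : y = x j := by
      by_contra hne
      exact ((hF _).1 hA).2 hyA hjA hne (hyx.trans hij)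
    rw [← hyi, this, hxc j hj]
  by_cases hcase : ∃ i < w, x i ≤ a
  · obtain ⟨i, hi, hia⟩ := hcase
    -- `P` is a chain that meets every `w`-antichain of `s'`, so removing it lowers the width below
    -- `w`.
    let P : α → Prop := fun z => z = a ∨ (c z = i ∧ z ≤ x i)
    let t := s.filter fun z => ¬ P z
    have hts : t ⊆ s' := by
      intro z hz
      obtain ⟨h1, h2⟩ := Finset.mem_filter.1 hz
      exact Finset.mem_erase.2 ⟨fun e => h2 (Or.inl e), h1⟩
    obtain ⟨d, hdw, hd⟩ := ih t.card
      (by rw [← hn]; exact (Finset.card_le_card hts).trans_lt (Finset.card_erase_lt_of_mem has))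
      t (w - 1) (by
        intro A hAt hA
        have hAF : A ∈ F := (hF A).2 ⟨hAt.trans hts, hA⟩
        have hle := hmaxA A hAF
        by_contra hlt
        have hAw : A.card = w := by omega
        obtain ⟨y, hyA, hyi⟩ := hmeet A hAF hAw i hi
        have hyx := hxm i hi y (Finset.mem_filter.2 ⟨hts (hAt hyA), hyi, A, hAF, hAw, hyA⟩)
        exact (Finset.mem_filter.1 (hAt hyA)).2 (Or.inr ⟨hyi, hyx⟩)) rfl
    refine ⟨fun z => if P z then w - 1 else d z, ?_, ?_⟩
    · intro z hz
      dsimp only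
      split_ifs with hP
      · omega
      · have := hdw z (Finset.mem_filter.2 ⟨hz, hP⟩)
        omega
    · intro p hp q hq hpq
      dsimp only at hpq
      split_ifs at hpq with h1 h2 h2
      · by_cases hpa : p = a
        · by_cases hqa : q = a
          · exact Or.inl (hpa.trans hqa.symm).le
          · rcases h2 with h2 | h2
            · exact absurd h2 hqa
            · exact Or.inr (hpa ▸ h2.2.trans hia)
        · rcases h1 with h1 | h1
          · exact absurd h1 hpa
          by_cases hqa : q = a
          · exact Or.inl (hqa ▸ h1.2.trans hia)
          · rcases h2 with h2 | h2
            · exact absurd h2 hqa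
            · exact hc p (Finset.mem_erase.2 ⟨hpa, hp⟩) q (Finset.mem_erase.2 ⟨hqa, hq⟩)
                (h1.1.trans h2.1.symm)
      · have := hdw q (Finset.mem_filter.2 ⟨hq, h2⟩)
        omega
      · have := hdw p (Finset.mem_filter.2 ⟨hp, h1⟩)
        omega
      · exact hd p (Finset.mem_filter.2 ⟨hp, h1⟩) q (Finset.mem_filter.2 ⟨hq, h2⟩) hpq
  · push Not at hcase
    -- Here `a` is incomparable to every `x i`, so `B` is an antichain of size `w + 1`. Hence `w <
    -- k`, and `a` can receive the new colour `w`.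
    let B := insert a ((Finset.range w).image x)
    have hinj : Set.InjOn x (Finset.range w) := fun i hi j hj hij =>
      hanti i (Finset.mem_range.1 hi) j (Finset.mem_range.1 hj) hij.le
    have haB : a ∉ (Finset.range w).image x := by
      intro hmem
      obtain ⟨i, hi, rfl⟩ := Finset.mem_image.1 hmem
      exact hcase i (Finset.mem_range.1 hi) le_rfl
    have hBcard : B.card = w + 1 := by
      rw [Finset.card_insert_of_notMem haB, Finset.card_image_of_injOn hinj, Finset.card_range]
    have hBk : w + 1 ≤ k := by
      rw [← hBcard]
      apply h
      · intro z hz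
        rcases Finset.mem_insert.1 hz with rfl | hz
        · exact has
        · obtain ⟨i, hi, rfl⟩ := Finset.mem_image.1 hz
          exact hs's (hxs i (Finset.mem_range.1 hi))
      · intro p hp q hq hne hpq
        rcases Finset.mem_insert.1 hp with rfl | hp' <;> rcases Finset.mem_insert.1 hq with rfl | hq'
        · exact hne rfl
        · obtain ⟨i, hi, rfl⟩ := Finset.mem_image.1 hq'
          exact hcase i (Finset.mem_range.1 hi)
            (hamax (hs's (hxs i (Finset.mem_range.1 hi))) hpq)
        · obtain ⟨i, hi, rfl⟩ := Finset.mem_image.1 hp'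
          exact hcase i (Finset.mem_range.1 hi) hpq
        · obtain ⟨i, hi, rfl⟩ := Finset.mem_image.1 hp'
          obtain ⟨j, hj, rfl⟩ := Finset.mem_image.1 hq'
          exact hne (congrArg x (hanti i (Finset.mem_range.1 hi) j (Finset.mem_range.1 hj) hpq))
    have hmem : ∀ z ∈ s, z ≠ a → z ∈ s' := fun z hz hza => Finset.mem_erase.2 ⟨hza, hz⟩
    refine ⟨fun z => if z = a then w else c z, ?_, ?_⟩
    · intro z hz
      dsimp only
      split_ifs with hza
      · omega
      · have := hcw z (hmem z hz hza)
        omega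
    · intro p hp q hq hpq
      dsimp only at hpq
      split_ifs at hpq with h1 h2 h2
      · exact Or.inl (h1.trans h2.symm).le
      · have := hcw q (hmem q hq h2)
        omega
      · have := hcw p (hmem p hp h1)
        omega
      · exact hc p (hmem p hp h1) q (hmem q hq h2) hpq

end Dilworth

/-! ### Order dimension and the number of covers -/

section OrderDimension

variable {L : Type v} [DistribLattice L]

/-- Two distinct covers of `x` meet in `x`, so by distributivity `t` meets the join of `x` and the
other covers inside `x`. -/
theorem not_le_sup_erase_of_covBy [OrderBot L] [DecidableEq L] {x : L} {T : Finset L}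
    (hT : ∀ y ∈ T, x ⋖ y) {t : L} (ht : t ∈ T) : ¬ t ≤ x ⊔ (T.erase t).sup id := by
  intro h
  have hle : t ⊓ (x ⊔ (T.erase t).sup id) ≤ x := by
    rw [inf_sup_left, Finset.sup_inf_distrib_left]
    refine sup_le inf_le_right (Finset.sup_le fun s hs => ?_)
    obtain ⟨hst, hs⟩ := Finset.mem_erase.1 hs
    by_contra hx
    have hx' : x < t ⊓ s :=
      (le_inf (hT t ht).le (hT s hs).le).lt_of_not_ge hx
    have h1 : t ⊓ s = t := (inf_le_left.lt_or_eq).resolve_left fun h => (hT t ht).2 hx' h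
    have h2 : t ⊓ s = s := (inf_le_right.lt_or_eq).resolve_left fun h => (hT s hs).2 hx' h
    exact hst (h2.symm.trans h1)
  exact (hT t ht).lt.not_ge ((le_inf le_rfl h).trans hle)

variable [Finite L]

theorem ncard_cov_le_orderDimension (x : L) : ((cov x).ncard : ℕ∞) ≤ orderDimension L := by
  classical
  have : Nonempty L := ⟨x⟩
  let _ := Fintype.ofFinite L
  let _ : OrderBot L := Fintype.toOrderBot L
  refine le_iInf₂ fun t ⟨r, hr, hle⟩ => ?_
  let T : Finset L := (cov x).toFinset
  have hT : ∀ y ∈ T, x ⋖ y := fun y hy => (Set.mem_toFinset (s := cov x)).1 hy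
  have hi : ∀ y ∈ T, ∃ i, ¬ r i y (x ⊔ (T.erase y).sup id) := fun y hy => by
    have := not_le_sup_erase_of_covBy hT hy
    rw [hle] at this
    exact not_forall.1 this
  rw [Set.ncard_eq_toFinset_card']
  rcases T.eq_empty_or_nonempty with h0 | ⟨y₀, hy₀⟩
  · change ((T.card : ℕ) : ℕ∞) ≤ t
    simp [h0]
  have : Nonempty (Fin t) := ⟨(hi y₀ hy₀).choose⟩
  choose! i hi using hi
  -- The extension `i y` reverses `y` and the join of the others, so `y` is its greatest element on
  -- `T`. This makes `i` injective.
  have key : ∀ y ∈ T, ∀ y' ∈ T, y' ≠ y → r (i y) y' y := fun y hy y' hy' hne => by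
    have := (hr (i y)).1
    have h1 := (total_of (r (i y)) y (x ⊔ (T.erase y).sup id)).resolve_left (hi y hy)
    have h2 : y' ≤ x ⊔ (T.erase y).sup id :=
      le_sup_of_le_right (Finset.le_sup (f := id) (Finset.mem_erase.2 ⟨hne, hy'⟩))
    exact trans_of (r (i y)) ((hr _).2 _ _ h2) h1
  have hcard := Finset.card_le_card_of_injOn (s := T) (t := Finset.univ) i (by simp)
    (fun y hy y' hy' hyy' => by
      by_contra hne
      have := (hr (i y)).1
      have h2 := key y' hy' y hy hne
      rw [← hyy'] at h2
      exact hne (antisymm_of (r (i y)) h2 (key y hy y' hy' (Ne.symm hne))))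
  rw [Finset.card_univ, Fintype.card_fin] at hcard
  exact_mod_cast hcard

/-- An antichain of join-irreducible elements gives an element with as many covers. -/
theorem exists_card_le_ncard_cov_of_isAntichain [Nonempty L] (A : Finset L)
    (hA : ∀ p ∈ A, SupIrred p) (hanti : IsAntichain (· ≤ ·) (A : Set L)) :
    ∃ x : L, A.card ≤ (cov x).ncard := by
  classical
  let _ := Fintype.ofFinite L
  let _ : OrderBot L := Fintype.toOrderBot L
  -- This join contains everything strictly below a member of `A`. Since members of `A` are
  -- join-prime and incomparable, it contains none of them, so each `x ⊔ p` covers `x`.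
  let x : L := (Finset.univ.filter fun v => ∃ p ∈ A, v < p).sup id
  have hlt : ∀ p ∈ A, ∀ v < p, v ≤ x := fun p hp v hv =>
    Finset.le_sup (f := id) (Finset.mem_filter.2 ⟨Finset.mem_univ _, p, hp, hv⟩)
  have hx : ∀ p ∈ A, ¬ p ≤ x := by
    intro p hp hpx
    obtain ⟨v, hv, hpv⟩ := (hA p hp).supPrime.le_finset_sup.1 hpx
    obtain ⟨-, q, hq, hvq⟩ := Finset.mem_filter.1 hv
    have hpq : p < q := lt_of_le_of_lt hpv hvq
    exact hanti hp hq hpq.ne hpq.le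
  refine ⟨x, ?_⟩
  rw [← Set.ncard_coe_finset]
  refine Set.ncard_le_ncard_of_injOn (fun p => x ⊔ p) (fun p hp => ?_) (fun p hp q hq hpq => ?_)
    (Set.toFinite _)
  · refine ⟨left_lt_sup.2 (hx p hp), fun u hxu hup => ?_⟩
    rcases (inf_le_right : u ⊓ p ≤ p).lt_or_eq with h | h
    · have h1 : u ⊓ (x ⊔ p) ≤ x := by
        rw [inf_sup_left]
        exact sup_le inf_le_right (hlt p hp _ h)
      exact hxu.not_ge ((le_inf le_rfl hup.le).trans h1)
    · exact hup.not_ge (sup_le hxu.le (inf_eq_right.1 h))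
  · have h1 : p ≤ x ⊔ q := (le_sup_right : p ≤ x ⊔ p).trans (le_of_eq hpq)
    by_contra hne
    exact hanti hp hq hne (((hA p hp).supPrime.2 h1).resolve_left (hx p hp))

theorem orderDimension_le_of_ncard_cov_le [Nonempty L] (k : ℕ) (hk : ∀ x : L, (cov x).ncard ≤ k) :
    orderDimension L ≤ k := by
  classical
  let _ := Fintype.ofFinite L
  let _ : OrderBot L := Fintype.toOrderBot L
  let J : Finset L := Finset.univ.filter SupIrred
  obtain ⟨c, hck, hc⟩ := exists_chain_coloring J k fun A hAJ hA => by
    obtain ⟨x, hx⟩ := exists_card_le_ncard_cov_of_isAntichain A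
      (fun p hp => (Finset.mem_filter.1 (hAJ hp)).2) hA
    exact hx.trans (hk x)
  -- `D i x` is an initial segment of the `i`-th chain. Such segments are nested, so comparing them
  -- amounts to comparing cardinalities.
  let D : ℕ → L → Finset L := fun i x => J.filter fun p => c p = i ∧ p ≤ x
  have hDmono : ∀ i x y, x ≤ y → D i x ⊆ D i y := fun i x y hxy p hp => by
    obtain ⟨h1, h2, h3⟩ := Finset.mem_filter.1 hp
    exact Finset.mem_filter.2 ⟨h1, h2, h3.trans hxy⟩
  have hDchain : ∀ i x y, D i x ⊆ D i y ∨ D i y ⊆ D i x := by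
    intro i x y
    by_contra hcon
    rw [not_or, Finset.not_subset, Finset.not_subset] at hcon
    obtain ⟨⟨p, hp, hp'⟩, q, hq, hq'⟩ := hcon
    obtain ⟨h1, h2, h3⟩ := Finset.mem_filter.1 hp
    obtain ⟨h4, h5, h6⟩ := Finset.mem_filter.1 hq
    rcases hc p h1 q h4 (h2.trans h5.symm) with h | h
    · exact hp' (Finset.mem_filter.2 ⟨h1, h2, h.trans h6⟩)
    · exact hq' (Finset.mem_filter.2 ⟨h4, h5, h.trans h3⟩)
  -- A fixed linear extension breaks ties between elements with equal segments.
  obtain ⟨σ, hσ, hleσ⟩ := extend_partialOrder ((· ≤ ·) : L → L → Prop)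
  let r : Fin k → L → L → Prop := fun i x y =>
    (D i x).card < (D i y).card ∨ (D i x).card = (D i y).card ∧ σ x y
  refine iInf₂_le k ⟨r, fun i => ⟨?_, fun x y hxy => ?_⟩, fun x y => ⟨fun hxy i => ?_, fun h => ?_⟩⟩
  · exact
      { refl := fun x => Or.inr ⟨rfl, refl_of σ x⟩
        trans := by
          rintro x y z (h | ⟨h, h'⟩) (g | ⟨g, g'⟩)
          · exact Or.inl (h.trans g)
          · exact Or.inl (h.trans_eq g)
          · exact Or.inl (h.trans_lt g)
          · exact Or.inr ⟨h.trans g, trans_of σ h' g'⟩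
        antisymm := by
          rintro x y (h | ⟨h, h'⟩) (g | ⟨g, g'⟩)
          · omega
          · omega
          · omega
          · exact antisymm_of σ h' g'
        total := fun x y => by
          rcases lt_trichotomy (D i x).card (D i y).card with h | h | h
          · exact Or.inl (Or.inl h)
          · exact (total_of σ x y).imp (fun g => Or.inr ⟨h, g⟩) fun g => Or.inr ⟨h.symm, g⟩
          · exact Or.inr (Or.inl h) }
  · exact (Finset.card_le_card (hDmono i x y hxy)).lt_or_eq.imp id fun h => ⟨h, hleσ x y hxy⟩
  · exact (Finset.card_le_card (hDmono i x y hxy)).lt_or_eq.imp id fun h => ⟨h, hleσ x y hxy⟩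
  · obtain ⟨s, hs, hirr⟩ := exists_supIrred_decomposition x
    rw [← hs]
    refine Finset.sup_le fun p hp => ?_
    have hpJ : p ∈ J := Finset.mem_filter.2 ⟨Finset.mem_univ _, hirr hp⟩
    have hpx : p ≤ x := hs ▸ Finset.le_sup (f := id) hp
    have hcard : (D (c p) x).card ≤ (D (c p) y).card :=
      (h ⟨c p, hck p hpJ⟩).elim le_of_lt fun g => g.1.le
    have hsub : D (c p) x ⊆ D (c p) y := (hDchain (c p) x y).elim id fun g =>
      (Finset.eq_of_subset_of_card_le g hcard).ge
    exact (Finset.mem_filter.1 (hsub (Finset.mem_filter.2 ⟨hpJ, rfl, hpx⟩))).2.2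

end OrderDimension

/-! ### Right modules supported on convex subsets -/

section IntervalModule

open MulOpposite

variable (K : Type u) [Field K] {L : Type v}

/-- The functions `L → K` supported on `C`. -/
@[ext]
structure IntervalModule (C : Set L) : Type (max u v) where
  /-- The underlying function. -/
  val : L → K
  /-- The function vanishes outside `C`. -/
  property : ∀ w ∉ C, val w = 0

variable {K}

namespace IntervalModule

theorem ext_on {C : Set L} {f g : IntervalModule K C} (h : ∀ w ∈ C, f.1 w = g.1 w) : f = g := by
  refine IntervalModule.ext (funext fun w => ?_)
  by_cases hw : w ∈ C
  · exact h w hw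
  · rw [f.2 w hw, g.2 w hw]

/-- The additive group of functions supported on `C`. -/
def supportedFunctions (K : Type u) [Field K] (C : Set L) : AddSubgroup (L → K) where
  carrier := {f : L → K | ∀ w ∉ C, f w = 0}
  add_mem' := fun {f g} hf hg w hw => by simp [hf w hw, hg w hw]
  zero_mem' := fun _ _ => rfl
  neg_mem' := fun {f} hf w hw => by simp [hf w hw]

/-- The elements of the interval module are the functions supported on `C`. -/
def equivSupportedFunctions (C : Set L) : IntervalModule K C ≃ supportedFunctions K C where
  toFun f := ⟨f.1, f.2⟩
  invFun f := ⟨f.1, f.2⟩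

instance (C : Set L) : AddCommGroup (IntervalModule K C) :=
  (equivSupportedFunctions C).addCommGroup

@[simp] theorem zero_val {C : Set L} (w : L) : (0 : IntervalModule K C).1 w = 0 := rfl

@[simp] theorem add_val {C : Set L} (f g : IntervalModule K C) (w : L) :
    (f + g).1 w = f.1 w + g.1 w := rfl

/-- The element of the incidence algebra whose only nonzero row is the row at `x`, where it is
given by `f`. -/
def row [PartialOrder L] [DecidableEq L] (x : L) (f : IntervalModule K (Set.Ici x)) : IncidenceAlgebra K L :=
  ⟨fun v w => if v = x then f.1 w else 0, fun v w h => by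
    split_ifs with hv
    · exact f.2 w (by rwa [Set.mem_Ici, ← hv])
    · rfl⟩

theorem row_apply [PartialOrder L] [DecidableEq L] (x : L) (f : IntervalModule K (Set.Ici x)) (v w : L) :
    row x f v w = if v = x then f.1 w else 0 := rfl

variable [PartialOrder L] [Fintype L]

open Classical in
/-- For a convex subset `C`, the basis element `p^v_w` of the incidence algebra maps the basis
vector at `v ∈ C` to the basis vector at `w` if `w ∈ C`, and to `0` otherwise. -/
noncomputable instance (C : Set L) : SMul (IncidenceAlgebra K L)ᵐᵒᵖ (IntervalModule K C) where
  smul a f := ⟨fun w => if w ∈ C then ∑ v, f.1 v * a.unop v w else 0, fun _ hw => if_neg hw⟩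

theorem smul_val {C : Set L} (a : (IncidenceAlgebra K L)ᵐᵒᵖ) (f : IntervalModule K C) {w : L}
    (hw : w ∈ C) : (a • f).1 w = ∑ v, f.1 v * a.unop v w := if_pos hw

/-- The basis vector at `x`. -/
def single [DecidableEq L] {C : Set L} (x : L) (hx : x ∈ C) : IntervalModule K C :=
  ⟨Pi.single x 1, fun w hw => Pi.single_eq_of_ne (fun h => hw (by rwa [h])) _⟩

/-- The basis vector at `x` generates `e_x A`. -/
theorem op_row_smul_single [DecidableEq L] (x : L) (f : IntervalModule K (Set.Ici x)) :
    op (row x f) • single x (Set.mem_Ici.2 le_rfl) = f := by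
  refine ext_on fun w hw => ?_
  rw [smul_val _ _ hw]
  simp [single, row_apply, Pi.single_apply]

variable [DecidableEq L] [LocallyFiniteOrder L]

theorem sum_mul_mul_apply (f : L → K) (a b : IncidenceAlgebra K L) (w : L) :
    ∑ v, f v * (a * b) v w = ∑ u, (∑ v, f v * a v u) * b u w := by
  simp_rw [Finset.sum_mul]
  rw [Finset.sum_comm]
  refine Finset.sum_congr rfl fun v _ => ?_
  rw [IncidenceAlgebra.mul_apply, Finset.mul_sum]
  refine Finset.sum_subset_zero_on_sdiff (Finset.subset_univ _) (fun u hu => ?_)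
    (fun u _ => (mul_assoc _ _ _).symm)
  have hu' : ¬ (v ≤ u ∧ u ≤ w) := fun h => (Finset.mem_sdiff.1 hu).2 (Finset.mem_Icc.2 h)
  by_cases hvu : v ≤ u
  · rw [b.apply_eq_zero_of_not_le fun h => hu' ⟨hvu, h⟩, mul_zero]
  · rw [a.apply_eq_zero_of_not_le hvu, mul_zero, zero_mul]

/-- Convexity gives associativity: the truncation to `C` drops only intermediate points `u ∉ C`, and
no such `u` lies between two points of `C`. -/
noncomputable instance (C : Set L) [C.OrdConnected] :
    Module (IncidenceAlgebra K L)ᵐᵒᵖ (IntervalModule K C) where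
  one_smul f := by
    refine ext_on fun w hw => ?_
    rw [smul_val _ _ hw]
    simp
  mul_smul a b f := by
    refine ext_on fun w hw => ?_
    rw [smul_val _ _ hw, smul_val _ _ hw, unop_mul, sum_mul_mul_apply]
    refine Finset.sum_congr rfl fun u _ => ?_
    by_cases hu : u ∈ C
    · rw [smul_val _ _ hu]
    · rw [(b • f).2 u hu, zero_mul]
      by_cases huw : u ≤ w
      · rw [Finset.sum_eq_zero, zero_mul]
        intro v _
        by_cases hv : v ∈ C
        · rw [IncidenceAlgebra.apply_eq_zero_of_not_le, mul_zero]
          exact fun hvu => hu (Set.OrdConnected.out ‹_› hv hw ⟨hvu, huw⟩)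
        · rw [f.2 v hv, zero_mul]
      · rw [IncidenceAlgebra.apply_eq_zero_of_not_le huw, mul_zero]
  smul_zero a := by
    refine ext_on fun w hw => ?_
    rw [smul_val _ _ hw]
    simp
  zero_smul f := by
    refine ext_on fun w hw => ?_
    rw [smul_val _ _ hw]
    simp
  smul_add a f g := by
    refine ext_on fun w hw => ?_
    simp [smul_val _ _ hw, add_mul, Finset.sum_add_distrib]
  add_smul a b f := by
    refine ext_on fun w hw => ?_
    simp [smul_val _ _ hw, mul_add, Finset.sum_add_distrib]

open Classical in
/-- The map between interval modules given by restriction and extension by zero. -/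
noncomputable def transfer {C D : Set L} [C.OrdConnected] [D.OrdConnected]
    (h : ∀ v ∈ C, ∀ w ∈ D, v ≤ w → (v ∈ D ↔ w ∈ C)) :
    IntervalModule K C →ₗ[(IncidenceAlgebra K L)ᵐᵒᵖ] IntervalModule K D where
  toFun f := ⟨fun w => if w ∈ D then f.1 w else 0, fun _ hw => if_neg hw⟩
  map_add' f g := by
    refine ext_on fun w hw => ?_
    simp [hw]
  map_smul' a f := by
    refine ext_on fun w hw => ?_
    rw [RingHom.id_apply, smul_val _ _ hw]
    simp only [hw, if_true]
    -- The term at `v ≤ w` survives on one side when `w ∈ C` and on the other when `v ∈ D`; `h` says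
    -- that these conditions agree.
    by_cases hwC : w ∈ C
    · rw [smul_val _ _ hwC]
      refine Finset.sum_congr rfl fun v _ => ?_
      split_ifs with hvD
      · rfl
      · rw [zero_mul]
        by_cases hv : v ∈ C
        · rw [IncidenceAlgebra.apply_eq_zero_of_not_le, mul_zero]
          exact fun hvw => hvD ((h v hv w hw hvw).2 hwC)
        · rw [f.2 v hv, zero_mul]
    · rw [(a • f).2 w hwC, Finset.sum_eq_zero]
      intro v _
      split_ifs with hvD
      · by_cases hv : v ∈ C
        · rw [IncidenceAlgebra.apply_eq_zero_of_not_le, mul_zero]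
          exact fun hvw => hwC ((h v hv w hw hvw).1 hvD)
        · rw [f.2 v hv, zero_mul]
      · rw [zero_mul]

theorem transfer_val {C D : Set L} [C.OrdConnected] [D.OrdConnected]
    (h : ∀ v ∈ C, ∀ w ∈ D, v ≤ w → (v ∈ D ↔ w ∈ C)) (f : IntervalModule K C) {w : L}
    (hw : w ∈ D) : (transfer h f).1 w = f.1 w := if_pos hw

theorem transfer_injective {C D : Set L} [C.OrdConnected] [D.OrdConnected]
    (h : ∀ v ∈ C, ∀ w ∈ D, v ≤ w → (v ∈ D ↔ w ∈ C)) (hCD : C ⊆ D) :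
    Function.Injective (transfer (K := K) h) := fun f g hfg => by
  refine ext_on fun w hw => ?_
  rw [← transfer_val h f (hCD hw), hfg, transfer_val h g (hCD hw)]

theorem transfer_surjective {C D : Set L} [C.OrdConnected] [D.OrdConnected]
    (h : ∀ v ∈ C, ∀ w ∈ D, v ≤ w → (v ∈ D ↔ w ∈ C)) (hDC : D ⊆ C) :
    Function.Surjective (transfer (K := K) h) := fun f =>
  ⟨⟨f.1, fun w hw => f.2 w fun hw' => hw (hDC hw')⟩, by
    refine ext_on fun w hw => ?_
    rw [transfer_val h _ hw]⟩

/-- The projective module `e_x A` as a submodule of `A`. -/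
def rowHom (x : L) :
    IntervalModule K (Set.Ici x) →ₗ[(IncidenceAlgebra K L)ᵐᵒᵖ] (IncidenceAlgebra K L)ᵐᵒᵖ where
  toFun f := op (row x f)
  map_add' f g := by
    rw [← MulOpposite.op_add]
    congr 1
    ext v w _
    simp only [row_apply, IncidenceAlgebra.add_apply, add_val]
    split_ifs <;> simp
  map_smul' a f := by
    rw [RingHom.id_apply, smul_eq_mul, ← op_unop a, ← MulOpposite.op_mul]
    congr 1
    ext v w hvw
    rw [row_apply, IncidenceAlgebra.mul_apply]
    simp only [row_apply]
    split_ifs with hv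
    · subst hv
      rw [smul_val _ _ (Set.mem_Ici.2 hvw)]
      symm
      refine Finset.sum_subset (Finset.subset_univ _) fun u _ hu => ?_
      have hu' : ¬ (v ≤ u ∧ u ≤ w) := fun h => hu (Finset.mem_Icc.2 h)
      by_cases hvu : v ≤ u
      · rw [IncidenceAlgebra.apply_eq_zero_of_not_le fun h => hu' ⟨hvu, h⟩, mul_zero]
      · rw [f.2 u hvu, zero_mul]
    · simp

/-- `e_x A` is a direct summand of `A`, with retraction `a ↦ e_x a`. -/
instance projective_Ici (x : L) :
    Module.Projective (IncidenceAlgebra K L)ᵐᵒᵖ (IntervalModule K (Set.Ici x)) :=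
  Module.Projective.of_split (rowHom x)
    (LinearMap.toSpanSingleton _ _ (single x (Set.mem_Ici.2 le_rfl)))
    (LinearMap.ext fun f => op_row_smul_single x f)

/-- A map out of `e_x A` is determined by the image of `e_x`, on which `row x f` sees only the
coordinate at `x`; the simple module at `z` has none. Keeping `C` as a variable lets this apply to
`koszulSet x []`. -/
theorem hom_eq_zero_of_eq_Ici {C : Set L} [C.OrdConnected] {x z : L} (hC : C = Set.Ici x)
    (hxz : x ≠ z) (φ : IntervalModule K C →ₗ[(IncidenceAlgebra K L)ᵐᵒᵖ]
      IntervalModule K ({z} : Set L)) : φ = 0 := by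
  subst hC
  ext1 f
  rw [← op_row_smul_single x f, map_smul]
  refine ext_on fun w hw => ?_
  rw [smul_val _ _ hw]
  refine Finset.sum_eq_zero fun v _ => ?_
  by_cases hv : v = z
  · rw [unop_op, row_apply, if_neg (by rw [hv]; exact hxz.symm), mul_zero]
  · rw [(φ _).2 v hv, zero_mul]

end IntervalModule

end IntervalModule

/-! ### The modules `Q(x, l)`: short exact sequences, projective dimension and `Ext` -/

section KoszulModule

open MulOpposite Abelian

variable {L : Type v}

/-- The elements above `x` that are not above any element of `l`. The interval module of this set
is the quotient of `e_x A` by the submodule generated by the basis elements `p^x_y` for `y ∈ l`. -/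
def koszulSet [Preorder L] (x : L) (l : List L) : Set L :=
  {w | x ≤ w ∧ ∀ y ∈ l, ¬ y ≤ w}

instance [Preorder L] (x : L) (l : List L) : (koszulSet x l).OrdConnected :=
  ⟨fun _ hv _ hw _ hu => ⟨hv.1.trans hu.1, fun y hy hyu => hw.2 y hy (hyu.trans hu.2)⟩⟩

theorem koszulSet_nil [Preorder L] (x : L) : koszulSet x [] = Set.Ici x := by
  ext w
  simp [koszulSet]

theorem mem_koszulSet_cons [Preorder L] {x y w : L} {l : List L} :
    w ∈ koszulSet x (y :: l) ↔ w ∈ koszulSet x l ∧ ¬ y ≤ w := by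
  simp only [koszulSet, Set.mem_ofPred_eq, List.forall_mem_cons]
  tauto

theorem mem_koszulSet_sup [Lattice L] {x y w : L} {l : List L} :
    w ∈ koszulSet (x ⊔ y) l ↔ w ∈ koszulSet x l ∧ y ≤ w := by
  simp only [koszulSet, Set.mem_ofPred_eq, sup_le_iff]
  tauto

theorem mem_koszulSet_iff_mem_koszulSet_sup [Lattice L] {x y : L} {l : List L} :
    ∀ v ∈ koszulSet (x ⊔ y) l, ∀ w ∈ koszulSet x l, v ≤ w →
      (v ∈ koszulSet x l ↔ w ∈ koszulSet (x ⊔ y) l) := fun _ hv _ hw hvw =>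
  ⟨fun _ => mem_koszulSet_sup.2 ⟨hw, (mem_koszulSet_sup.1 hv).2.trans hvw⟩,
    fun _ => (mem_koszulSet_sup.1 hv).1⟩

theorem mem_koszulSet_cons_iff_mem_koszulSet [Preorder L] {x y : L} {l : List L} :
    ∀ v ∈ koszulSet x l, ∀ w ∈ koszulSet x (y :: l), v ≤ w →
      (v ∈ koszulSet x (y :: l) ↔ w ∈ koszulSet x l) := fun _ hv _ hw hvw =>
  ⟨fun _ => (mem_koszulSet_cons.1 hw).1,
    fun _ => mem_koszulSet_cons.2 ⟨hv, fun h => (mem_koszulSet_cons.1 hw).2 (h.trans hvw)⟩⟩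

variable (K : Type u) [Field K] [Fintype L] [DecidableEq L]

/-- The interval module of a convex set as an object of the category of right modules. -/
noncomputable abbrev intervalModuleCat [PartialOrder L] [LocallyFiniteOrder L]
    (C : Set L) [C.OrdConnected] : ModuleCat.{max u v} (IncidenceAlgebra K L)ᵐᵒᵖ :=
  ModuleCat.of _ (IntervalModule K C)

theorem projective_koszul_nil [PartialOrder L] [LocallyFiniteOrder L] (x : L) :
    Projective (intervalModuleCat K (koszulSet x [])) := by
  simp only [koszulSet_nil]
  infer_instance

variable [Lattice L] [LocallyFiniteOrder L]

/-- The inclusion `Q(x ⊔ y, l) → Q(x, l)` of interval modules. -/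
noncomputable def koszulInclusion (x y : L) (l : List L) :
    IntervalModule K (koszulSet (x ⊔ y) l) →ₗ[(IncidenceAlgebra K L)ᵐᵒᵖ]
      IntervalModule K (koszulSet x l) :=
  IntervalModule.transfer mem_koszulSet_iff_mem_koszulSet_sup

/-- The projection `Q(x, l) → Q(x, y :: l)` of interval modules. -/
noncomputable def koszulProjection (x y : L) (l : List L) :
    IntervalModule K (koszulSet x l) →ₗ[(IncidenceAlgebra K L)ᵐᵒᵖ]
      IntervalModule K (koszulSet x (y :: l)) :=
  IntervalModule.transfer mem_koszulSet_cons_iff_mem_koszulSet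

variable {K} in
theorem koszulInclusion_val {x y : L} {l : List L} (f : IntervalModule K (koszulSet (x ⊔ y) l))
    {w : L} (hw : w ∈ koszulSet x l) : (koszulInclusion K x y l f).1 w = f.1 w :=
  IntervalModule.transfer_val _ f hw

variable {K} in
theorem koszulProjection_val {x y : L} {l : List L} (f : IntervalModule K (koszulSet x l))
    {w : L} (hw : w ∈ koszulSet x (y :: l)) : (koszulProjection K x y l f).1 w = f.1 w :=
  IntervalModule.transfer_val _ f hw

variable {K} in
theorem koszul_exact (x y : L) (l : List L) :
    Function.Exact (koszulInclusion K x y l) (koszulProjection K x y l) := by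
  refine fun f => ⟨fun hf => ?_, ?_⟩
  · refine ⟨⟨f.1, fun w hw => ?_⟩, IntervalModule.ext_on fun w hw => koszulInclusion_val _ hw⟩
    by_cases hwx : w ∈ koszulSet x l
    · have hw' : w ∈ koszulSet x (y :: l) :=
        mem_koszulSet_cons.2 ⟨hwx, fun h => hw (mem_koszulSet_sup.2 ⟨hwx, h⟩)⟩
      rw [← koszulProjection_val f hw', hf]
      rfl
    · exact f.2 w hwx
  · rintro ⟨g, rfl⟩
    refine IntervalModule.ext_on fun w hw => ?_
    obtain ⟨hw1, hw2⟩ := mem_koszulSet_cons.1 hw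
    rw [koszulProjection_val _ hw, koszulInclusion_val _ hw1]
    exact g.2 w fun h => hw2 (mem_koszulSet_sup.1 h).2

/-- The short complex `Q(x ⊔ y, l) → Q(x, l) → Q(x, y :: l)` of interval modules. -/
noncomputable def koszulShortComplex (x y : L) (l : List L) :
    ShortComplex (ModuleCat.{max u v} (IncidenceAlgebra K L)ᵐᵒᵖ) :=
  ShortComplex.moduleCatMk (koszulInclusion K x y l) (koszulProjection K x y l)
    (koszul_exact x y l).linearMap_comp_eq_zero

/-- The support of `Q(x, l)` splits into the points above `y`, which support the submodule, and the
remaining points, which support the quotient. -/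
theorem koszulShortComplex_shortExact (x y : L) (l : List L) :
    (koszulShortComplex K x y l).ShortExact :=
  ModuleCat.shortComplex_shortExact _ (koszul_exact x y l)
    (IntervalModule.transfer_injective mem_koszulSet_iff_mem_koszulSet_sup fun _ hw => (mem_koszulSet_sup.1 hw).1)
    (IntervalModule.transfer_surjective mem_koszulSet_cons_iff_mem_koszulSet fun _ hw => (mem_koszulSet_cons.1 hw).1)

theorem hasProjectiveDimensionLE_koszul (x : L) (l : List L) :
    HasProjectiveDimensionLE (intervalModuleCat K (koszulSet x l)) l.length := by
  induction l generalizing x with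
  | nil =>
    have := projective_koszul_nil K x
    exact inferInstanceAs (HasProjectiveDimensionLT _ 1)
  | cons y l ih =>
    exact (koszulShortComplex_shortExact K x y l).hasProjectiveDimensionLT_X₃ _ (ih (x ⊔ y))
      (have := ih x; 
        hasProjectiveDimensionLT_of_ge (intervalModuleCat K (koszulSet x l)) (l.length + 1) _
          (by simp))

/-- The simple module at `z`. -/
noncomputable abbrev simpleModuleCat (z : L) : ModuleCat.{max u v} (IncidenceAlgebra K L)ᵐᵒᵖ :=
  intervalModuleCat K ({z} : Set L)

theorem ext_koszul_nil_eq_zero {x z : L} (hxz : x ≠ z) (n : ℕ)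
    (e : Ext (intervalModuleCat K (koszulSet x [])) (simpleModuleCat K z) n) : e = 0 := by
  cases n with
  | zero =>
    obtain ⟨f, rfl⟩ := Ext.homEquiv₀.symm.surjective e
    have : f = 0 :=
      ModuleCat.hom_ext (IntervalModule.hom_eq_zero_of_eq_Ici (koszulSet_nil x) hxz f.hom)
    rw [this]
    simp
  | succ n =>
    have := projective_koszul_nil K x
    exact e.eq_zero_of_projective

/-- Unwinding the sequences leads only to the projectives `e_u A` with `u ≤ b`. Since `z ≰ b`, each
such `u` differs from `z`. -/
theorem ext_koszul_eq_zero {x z b : L} {l : List L} (hxb : x ≤ b) (hlb : ∀ y ∈ l, y ≤ b)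
    (hzb : ¬ z ≤ b) (n : ℕ)
    (e : Ext (intervalModuleCat K (koszulSet x l)) (simpleModuleCat K z) n) : e = 0 := by
  induction l generalizing x n with
  | nil => exact ext_koszul_nil_eq_zero K (fun h => hzb (h.ge.trans hxb)) n e
  | cons y l ih =>
    rw [List.forall_mem_cons] at hlb
    have hS := koszulShortComplex_shortExact K x y l
    cases n with
    | zero =>
      have := hS.epi_g
      exact Ext.precomp_mk₀_injective_of_epi (simpleModuleCat K z) (koszulShortComplex K x y l).g
        ((ih hxb hlb.2 0 _).trans (ih hxb hlb.2 0 _).symm)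
    | succ n =>
      obtain ⟨e', rfl⟩ := Ext.contravariant_sequence_exact₃ hS (simpleModuleCat K z) e
        (ih hxb hlb.2 (n + 1) _) (add_comm 1 n)
      have h0 : e' = 0 := ih (sup_le hxb hlb.1) hlb.2 n e'
      rw [h0, Ext.comp_zero]
      rfl

/-- Here `z` is the join of `x` and `l`, and `hind` says that this join drops when any member of `l`
is omitted. Hence `Ext` of `Q(x, l)` into the simple module at `z` vanishes, and the connecting map
carries a nonzero class for `Q(x ⊔ y, l)` to one for `Q(x, y :: l)`. The base case is the projection
of `e_z A` onto its simple quotient. -/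
theorem exists_ext_koszul_ne_zero {x z : L} {l : List L} (hl : l.Nodup) (hxz : x ≤ z)
    (hlz : ∀ y ∈ l, y ≤ z) (hz : ∀ b, x ≤ b → (∀ y ∈ l, y ≤ b) → z ≤ b)
    (hind : ∀ t ∈ l, ∃ b, x ≤ b ∧ (∀ s ∈ l, s ≠ t → s ≤ b) ∧ ¬ t ≤ b) :
    ∃ e : Ext (intervalModuleCat K (koszulSet x l)) (simpleModuleCat K z) l.length, e ≠ 0 := by
  induction l generalizing x with
  | nil =>
    obtain rfl : x = z := le_antisymm hxz (hz x le_rfl (by simp))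
    have hsub : ({x} : Set L) ⊆ koszulSet x [] := by simp [koszulSet_nil]
    have htop : ∀ v ∈ koszulSet x [], ∀ w ∈ ({x} : Set L), v ≤ w →
        (v ∈ ({x} : Set L) ↔ w ∈ koszulSet x []) := fun v hv w hw hvw =>
      ⟨fun _ => hsub hw, fun _ => le_antisymm (hvw.trans (Set.mem_singleton_iff.1 hw).le) hv.1⟩
    let φ : intervalModuleCat K (koszulSet x []) ⟶ simpleModuleCat K x :=
      ModuleCat.ofHom (IntervalModule.transfer htop)
    refine ⟨Ext.mk₀ φ, fun h => ?_⟩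
    rw [Ext.mk₀_eq_zero_iff] at h
    obtain ⟨f, hf⟩ := IntervalModule.transfer_surjective (K := K) htop hsub
      (IntervalModule.single x (Set.mem_singleton x))
    have h1 : φ.hom f = 0 := by rw [h]; rfl
    have h2 := hf.symm.trans h1
    have h3 := congrArg (fun g : IntervalModule K ({x} : Set L) => g.1 x) h2
    simp [IntervalModule.single] at h3
  | cons y l ih =>
    obtain ⟨hyl, hl⟩ := List.nodup_cons.1 hl
    rw [List.forall_mem_cons] at hlz
    obtain ⟨b, hxb, hb, hyb⟩ := hind y (by simp)
    obtain ⟨e, he⟩ := ih hl (sup_le hxz hlz.1) hlz.2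
      (fun b hb hlb => hz b (le_sup_left.trans hb)
        (List.forall_mem_cons.2 ⟨le_sup_right.trans hb, hlb⟩))
      (fun t ht => by
        obtain ⟨b, hxb, hb, htb⟩ := hind t (List.mem_cons_of_mem _ ht)
        have hyt : y ≠ t := fun h => hyl (h ▸ ht)
        exact ⟨b, sup_le hxb (hb y (by simp) hyt),
          fun s hs => hb s (List.mem_cons_of_mem _ hs), htb⟩)
    have hS := koszulShortComplex_shortExact K x y l
    change ∃ e : Ext (koszulShortComplex K x y l).X₃ (simpleModuleCat K z) (l.length + 1), e ≠ 0
    let e₁ : Ext (koszulShortComplex K x y l).X₁ (simpleModuleCat K z) l.length := e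
    refine ⟨hS.extClass.comp e₁ (add_comm 1 l.length), fun h => he ?_⟩
    -- A class killed by the connecting map comes from `Ext` of the middle term, which is zero.
    obtain ⟨e', he'⟩ := Ext.contravariant_sequence_exact₁ hS (simpleModuleCat K z) e₁ _ h
    have h0 : e' = 0 := ext_koszul_eq_zero K hxb
      (fun s hs => hb s (List.mem_cons_of_mem _ hs) fun h => hyl (h ▸ hs))
      (fun h => hyb (hlz.1.trans h)) _ e'
    rw [h0, Ext.comp_zero] at he'
    exact he'.symm

end KoszulModule

/-! ### Classification of the simple modules, and reduction to them -/

section SimpleModules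

open MulOpposite

namespace IntervalModule

variable {K : Type u} [Field K] {L : Type v} [PartialOrder L]

theorem mem_singleton_iff_mem_Ici (x : L) : ∀ v ∈ Set.Ici x, ∀ w ∈ ({x} : Set L), v ≤ w →
    (v ∈ ({x} : Set L) ↔ w ∈ Set.Ici x) := fun _ hv _ hw hvw =>
  ⟨fun _ => (Set.mem_singleton_iff.1 hw).ge,
    fun _ => le_antisymm (hvw.trans (Set.mem_singleton_iff.1 hw).le) hv⟩

variable [DecidableEq L]

/-- The idempotent `p^x_x` of the incidence algebra. -/
def idem (K : Type u) [Field K] (x : L) : IncidenceAlgebra K L :=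
  row x (single x (Set.mem_Ici.2 le_rfl))

theorem idem_apply (x v w : L) : idem K x v w = if v = x ∧ w = x then 1 else 0 := by
  simp only [idem, row_apply, single, Pi.single_apply, ite_and]

variable [LocallyFiniteOrder L]

theorem row_mul_idem_eq_zero {x w : L} (f : IntervalModule K (Set.Ici x)) (hf : f.1 w = 0) :
    row x f * idem K w = 0 := by
  ext v u _
  rw [IncidenceAlgebra.mul_apply]
  refine Finset.sum_eq_zero fun t _ => ?_
  rw [row_apply, idem_apply]
  by_cases ht : t = w
  · simp [ht, hf]
  · simp [ht]

variable [Fintype L]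

theorem sum_op_idem_smul {M : Type*} [AddCommGroup M] [Module (IncidenceAlgebra K L)ᵐᵒᵖ M]
    (m : M) : ∑ x : L, op (idem K x) • m = m := by
  have hsum : ∀ (s : Finset L) (v w : L), (∑ x ∈ s, idem K x) v w = ∑ x ∈ s, idem K x v w := by
    intro s v w
    induction s using Finset.induction_on with
    | empty => simp
    | insert a s ha ih => rw [Finset.sum_insert ha, Finset.sum_insert ha, ← ih]; rfl
  have hone : ∑ x : L, idem K x = 1 := by
    ext v w _
    rw [hsum, IncidenceAlgebra.one_apply]
    simp only [idem_apply, ite_and]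
    simp [eq_comm]
  rw [← Finset.sum_smul, ← Finset.op_sum, hone, MulOpposite.op_one, one_smul]

/-- The linear map `e_x A → M` given by `f ↦ m f`, mapping `e_x` to `m e_x`. -/
noncomputable def homOfElement {M : Type*} [AddCommGroup M] [Module (IncidenceAlgebra K L)ᵐᵒᵖ M] (x : L) (m : M) :
    IntervalModule K (Set.Ici x) →ₗ[(IncidenceAlgebra K L)ᵐᵒᵖ] M :=
  (LinearMap.toSpanSingleton _ M m).comp (rowHom x)

/-- For `x` maximal with `M e_x ≠ 0`, a nonzero `m e_x` gives a surjection `e_x A → M`. By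
maximality it kills every function vanishing at `x`, so its kernel is that of the projection onto
the simple module at `x`. -/
theorem nonempty_linearEquiv_of_isSimpleModule (M : Type*) [AddCommGroup M]
    [Module (IncidenceAlgebra K L)ᵐᵒᵖ M] [IsSimpleModule (IncidenceAlgebra K L)ᵐᵒᵖ M] :
    ∃ x : L, Nonempty
      (IntervalModule K ({x} : Set L) ≃ₗ[(IncidenceAlgebra K L)ᵐᵒᵖ] M) := by
  classical
  let T : Finset L := Finset.univ.filter fun x => ∃ m : M, op (idem K x) • m ≠ 0
  have hT : T.Nonempty := by
    have := IsSimpleModule.nontrivial (IncidenceAlgebra K L)ᵐᵒᵖ M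
    obtain ⟨m, hm⟩ := exists_ne (0 : M)
    by_contra hT
    rw [Finset.not_nonempty_iff_eq_empty, Finset.filter_eq_empty_iff] at hT
    apply hm
    rw [← sum_op_idem_smul (K := K) (L := L) m]
    exact Finset.sum_eq_zero fun x hx => by
      have := hT hx
      push Not at this
      exact this m
  obtain ⟨x, hxT, hmax⟩ := T.exists_maximal hT
  obtain ⟨m, hm⟩ := (Finset.mem_filter.1 hxT).2
  have hgt : ∀ w, x < w → ∀ m : M, op (idem K w) • m = 0 := fun w hw m => by
    by_contra hne
    exact hw.not_ge (hmax (Finset.mem_filter.2 ⟨Finset.mem_univ _, m, hne⟩) hw.le)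
  let ψ := homOfElement (K := K) x m
  let π := transfer (K := K) (mem_singleton_iff_mem_Ici x)
  have hψ : Function.Surjective ψ := LinearMap.surjective_of_ne_zero fun h => hm (by
    have := congrArg (fun φ => φ (single x (Set.mem_Ici.2 le_rfl))) h
    exact this)
  have hπ : Function.Surjective π := transfer_surjective _ (by simp)
  have hker : ∀ f : IntervalModule K (Set.Ici x), f.1 x = 0 → ψ f = 0 := fun f hf => by
    rw [← sum_op_idem_smul (K := K) (L := L) (ψ f)]
    refine Finset.sum_eq_zero fun w _ => ?_
    by_cases hw : x < w
    · exact hgt w hw _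
    · change op (idem K w) • (op (row x f) • m) = 0
      have hfw : f.1 w = 0 := by
        by_cases hwx : w = x
        · rw [hwx, hf]
        · exact f.2 w fun h => hw (lt_of_le_of_ne h (Ne.symm hwx))
      rw [smul_smul, ← MulOpposite.op_mul, row_mul_idem_eq_zero f hfw, MulOpposite.op_zero, zero_smul]
  have hker' : ∀ f : IntervalModule K (Set.Ici x), ψ f = 0 → f.1 x = 0 := fun f hf => by
    by_contra hne
    apply hm
    -- Scaling makes the value at `x` equal to `1`, so `a • f - s` vanishes at `x`. If `ψ f = 0`,
    -- then `ψ s = 0`, contradicting `hm`.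
    let a : (IncidenceAlgebra K L)ᵐᵒᵖ := op ((f.1 x)⁻¹ • 1)
    let s : IntervalModule K (Set.Ici x) := single x (Set.mem_Ici.2 le_rfl)
    have h1 : ψ (a • f - s) = 0 := by
      refine hker _ ?_
      have h2 : (a • f).1 x = 1 := by
        rw [smul_val _ _ (Set.mem_Ici.2 le_rfl)]
        simp [a, IncidenceAlgebra.constSMul_apply, hne]
      change (a • f).1 x - s.1 x = 0
      rw [h2]
      simp [s, single]
    rw [map_sub, map_smul, hf, smul_zero, zero_sub, neg_eq_zero] at h1
    exact h1
  have hkers : LinearMap.ker π = LinearMap.ker ψ := by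
    ext f
    rw [LinearMap.mem_ker, LinearMap.mem_ker]
    have hx := Set.mem_singleton x
    refine ⟨fun h => hker f ?_, fun h => ext_on fun w hw => ?_⟩
    · rw [← transfer_val (mem_singleton_iff_mem_Ici x) f hx]
      exact congrArg (fun g : IntervalModule K ({x} : Set L) => g.1 x) h
    · rw [transfer_val _ _ hw, Set.mem_singleton_iff.1 hw]
      exact hker' f h
  exact ⟨x, ⟨(π.quotKerEquivOfSurjective hπ).symm ≪≫ₗ Submodule.quotEquivOfEq _ _ hkers ≪≫ₗ
    ψ.quotKerEquivOfSurjective hψ⟩⟩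

instance finite_Ici (x : L) :
    Module.Finite (IncidenceAlgebra K L)ᵐᵒᵖ (IntervalModule K (Set.Ici x)) :=
  Module.Finite.of_surjective
    (LinearMap.toSpanSingleton (IncidenceAlgebra K L)ᵐᵒᵖ _ (single x (Set.mem_Ici.2 le_rfl)))
    fun f => ⟨op (row x f), op_row_smul_single x f⟩

end IntervalModule

theorem IncidenceAlgebra.module_finite (K : Type u) [Field K] (L : Type v) [PartialOrder L]
    [Fintype L] [DecidableEq L] [LocallyFiniteOrder L] :
    Module.Finite K (IncidenceAlgebra K L)ᵐᵒᵖ :=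
  let φ : (IncidenceAlgebra K L)ᵐᵒᵖ →ₗ[K] L → L → K :=
    { toFun := fun a => a.unop
      map_add' := fun _ _ => rfl
      map_smul' := fun _ _ => rfl }
  Module.Finite.of_injective φ fun _ _ h => unop_injective (DFunLike.coe_injective h)

/-- The algebra is finite-dimensional over `K`, hence Artinian. -/
theorem IncidenceAlgebra.isFiniteLength (K : Type u) [Field K] (L : Type v) [PartialOrder L]
    [Fintype L] [DecidableEq L] [LocallyFiniteOrder L] (M : Type*) [AddCommGroup M]
    [Module (IncidenceAlgebra K L)ᵐᵒᵖ M] [Module.Finite (IncidenceAlgebra K L)ᵐᵒᵖ M] :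
    IsFiniteLength (IncidenceAlgebra K L)ᵐᵒᵖ M := by
  have := IncidenceAlgebra.module_finite K L
  have := IsArtinianRing.of_finite K (IncidenceAlgebra K L)ᵐᵒᵖ
  exact isFiniteLength_iff_isNoetherian_isArtinian.2 ⟨inferInstance, inferInstance⟩

/-- A bound for the projective dimensions of the simple modules bounds the projective dimensions of
the modules of finite length. -/
theorem hasProjectiveDimensionLT_of_isFiniteLength {R : Type u} [Ring R] {n : ℕ}
    (h : ∀ (S : Type u) [AddCommGroup S] [Module R S] [IsSimpleModule R S],
      HasProjectiveDimensionLT (ModuleCat.of R S) n)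
    (M : Type u) [AddCommGroup M] [Module R M] (hM : IsFiniteLength R M) :
    HasProjectiveDimensionLT (ModuleCat.of R M) n := by
  induction hM with
  | @of_subsingleton M _ _ _ =>
    have := (ModuleCat.isZero_of_subsingleton (ModuleCat.of R M)).hasProjectiveDimensionLT_zero
    exact hasProjectiveDimensionLT_of_ge _ 0 _ n.zero_le
  | @of_simple_quotient M _ _ N _ _ ih =>
    have hex := LinearMap.exact_subtype_mkQ N
    exact (ModuleCat.shortComplex_shortExact
      (ShortComplex.moduleCatMk N.subtype N.mkQ hex.linearMap_comp_eq_zero) hex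
      N.injective_subtype N.mkQ_surjective).hasProjectiveDimensionLT_X₂ n ih (h (M ⧸ N))

end SimpleModules

/-! ### Global dimension -/

section GlobalDimension

variable {L : Type v}

theorem exists_nodup_list_cov [PartialOrder L] [Finite L] (x : L) :
    ∃ l : List L, l.Nodup ∧ (∀ y, y ∈ l ↔ x ⋖ y) ∧ l.length = (cov x).ncard := by
  classical
  let hfin : (cov x).Finite := Set.toFinite _
  refine ⟨hfin.toFinset.toList, Finset.nodup_toList _, fun y => ?_, ?_⟩
  · rw [Finset.mem_toList, Set.Finite.mem_toFinset]
    rfl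
  · rw [Finset.length_toList, Set.ncard_eq_toFinset_card _ hfin]

/-- Every element strictly above `x` lies above a cover of `x`; thus `Q(x, l)` is the simple module
at `x`. -/
theorem koszulSet_covers [PartialOrder L] [Finite L] {x : L} {l : List L}
    (hl : ∀ y, y ∈ l ↔ x ⋖ y) : koszulSet x l = {x} := by
  ext w
  refine ⟨fun hw => ?_, ?_⟩
  · by_contra hne
    obtain ⟨y, hxy, hyw⟩ := exists_covBy_le_of_lt (lt_of_le_of_ne hw.1 (Ne.symm hne))
    exact hw.2 y ((hl y).2 hxy) hyw
  · rintro rfl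
    exact ⟨le_rfl, fun y hy h => ((hl y).1 hy).lt.not_ge h⟩

variable (K : Type u) [Field K] [Fintype L] [DecidableEq L]

theorem module_finite_koszul [PartialOrder L] [LocallyFiniteOrder L] (x : L) (l : List L) :
    Module.Finite (IncidenceAlgebra K L)ᵐᵒᵖ (IntervalModule K (koszulSet x l)) :=
  Module.Finite.of_surjective
    (IntervalModule.transfer (C := Set.Ici x) (D := koszulSet x l) fun _ hv _ hw hvw =>
      ⟨fun _ => hw.1, fun _ => ⟨hv, fun y hy hyv => hw.2 y hy (hyv.trans hvw)⟩⟩)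
    (IntervalModule.transfer_surjective _ fun _ hw => hw.1)

theorem hasProjectiveDimensionLE_simple [Lattice L] [LocallyFiniteOrder L] (x : L) :
    HasProjectiveDimensionLE (simpleModuleCat K x) (cov x).ncard := by
  obtain ⟨l, -, hl, hlen⟩ := exists_nodup_list_cov x
  have h := hasProjectiveDimensionLE_koszul K x l
  simp only [koszulSet_covers hl] at h
  rwa [hlen] at h

theorem hasProjectiveDimensionLE_of_ncard_cov_le [Lattice L] [LocallyFiniteOrder L] {n : ℕ}
    (hn : ∀ x : L, (cov x).ncard ≤ n)
    (M : ModuleCat.{max u v} (IncidenceAlgebra K L)ᵐᵒᵖ)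
    [Module.Finite (IncidenceAlgebra K L)ᵐᵒᵖ M] : HasProjectiveDimensionLE M n := by
  refine hasProjectiveDimensionLT_of_isFiniteLength (fun S _ _ _ => ?_) M
    (IncidenceAlgebra.isFiniteLength K L M)
  obtain ⟨x, ⟨e⟩⟩ := IntervalModule.nonempty_linearEquiv_of_isSimpleModule (K := K) (L := L) S
  have := hasProjectiveDimensionLE_simple K x
  have := hasProjectiveDimensionLT_of_ge (simpleModuleCat K x) ((cov x).ncard + 1) (n + 1)
    (Nat.succ_le_succ (hn x))
  exact hasProjectiveDimensionLT_of_iso e.toModuleIso (n + 1)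

theorem not_hasProjectiveDimensionLT_koszul [DistribLattice L] [LocallyFiniteOrder L] {x : L}
    {l : List L} (hnodup : l.Nodup) (hl : ∀ y ∈ l, x ⋖ y) :
    ¬ HasProjectiveDimensionLT (intervalModuleCat K (koszulSet x l)) l.length := by
  intro h
  have : Nonempty L := ⟨x⟩
  let _ : OrderBot L := Fintype.toOrderBot L
  obtain ⟨e, he⟩ := exists_ext_koszul_ne_zero K (z := x ⊔ l.toFinset.sup id) hnodup le_sup_left
    (fun y hy => le_sup_of_le_right (Finset.le_sup (f := id) (List.mem_toFinset.2 hy)))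
    (fun b hxb hlb => sup_le hxb (Finset.sup_le fun y hy => hlb y (List.mem_toFinset.1 hy)))
    -- Independence is witnessed by the join of `x` and the covers other than `t`.
    (fun t ht => ⟨x ⊔ (l.toFinset.erase t).sup id, le_sup_left, fun s hs hst =>
      le_sup_of_le_right (Finset.le_sup (f := id)
        (Finset.mem_erase.2 ⟨hst, List.mem_toFinset.2 hs⟩)),
      not_le_sup_erase_of_covBy (fun y hy => hl y (List.mem_toFinset.1 hy))
        (List.mem_toFinset.2 ht)⟩)
  exact he (e.eq_zero_of_hasProjectiveDimensionLT _ le_rfl)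

end GlobalDimension

theorem theorem3p7 (K : Type u) [Field K] (L : Type v) [DistribLattice L] [Fintype L]
    [Nontrivial L] [DecidableEq L] [LocallyFiniteOrder L] :
    globalDimension (IncidenceAlgebra K L) = (orderDimension L : WithBot ℕ∞) ∧
    orderDimension L =
      ((Finset.univ.sup' Finset.univ_nonempty fun x : L => (cov x).ncard : ℕ) : ℕ∞) := by
  set n : ℕ := Finset.univ.sup' Finset.univ_nonempty fun x : L => (cov x).ncard
  have hle : ∀ x : L, (cov x).ncard ≤ n := fun x =>
    Finset.le_sup' (fun x : L => (cov x).ncard) (Finset.mem_univ x)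
  obtain ⟨x, -, hx⟩ : ∃ x ∈ Finset.univ, n = (cov (x : L)).ncard :=
    Finset.exists_mem_eq_sup' Finset.univ_nonempty fun x : L => (cov x).ncard
  have hdim : orderDimension L = n :=
    le_antisymm (orderDimension_le_of_ncard_cov_le n hle) (hx ▸ ncard_cov_le_orderDimension x)
  refine ⟨?_, hdim⟩
  rw [hdim]
  change globalDimension (IncidenceAlgebra K L) = (n : WithBot ℕ∞)
  refine le_antisymm (iSup₂_le fun M _ => ?_) ?_
  · exact (projectiveDimension_le_iff M n).2 (hasProjectiveDimensionLE_of_ncard_cov_le K hle M)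
  · obtain ⟨l, hnodup, hl, hlen⟩ := exists_nodup_list_cov x
    -- At an element `x` with the most covers, the simple module attains the bound.
    refine le_iSup₂_of_le (intervalModuleCat K (koszulSet x l)) (module_finite_koszul K x l) ?_
    rw [hx, ← hlen]
    exact (projectiveDimension_ge_iff _ _).2
      (not_hasProjectiveDimensionLT_koszul K hnodup fun y hy => (hl y).1 hy)
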